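/- Let a binary tree be a rooted plane tree in which every node has $0$ or $2$ children, and let its size be its total number of nodes (hence odd). A tree is generated by threads, with threshold $t$, as follows. A thread owns two linear data structures (both stacks, or both queues) $\ell_1,\ell_2$ of waiting nodes, $\ell_2$ being empty at the start. While $\ell_1$ is not empty, the thread pops a node from $\ell_2$ if $\ell_2$ is not empty, and from $\ell_1$ otherwise. If this node is a leaf, nothing is added. If it is an internal node, then (with $|\ell_1|$ measured after the pop) its two children are pushed into $\ell_1$ when $|\ell_1|<t$, and into $\ell_2$ when $|\ell_1|\ge t$; in the latter case, if now $|\ell_2|\ge t$, then $\ell_2$ is handed over to a new thread, as the $\ell_1$ of that thread, and is replaced by an empty structure. The first thread starts with $\ell_1$ containing only the root. Its lifetime is the number of nodes that it processes itself. Theorem. For odd $n$ let $L_n$ be the lifetime of the first thread, with threshold $t=4$, for a uniformly random binary tree of size $n$. Then, as $n\to\infty$ through the odd integers, $L_n$ converges in distribution to a random variable $X$ with values in $\mathbb{N}$ whose probability generating function is $$\mathbb{E}\left(u^X\right)=-\frac{u^{11}}{(u^4-16u^2+16)(u^6-18u^4+48u^2-32)}\qquad (u\in\mathbb{C},\ |u|\le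 1).$$ Moreover $\mathbb{E}(X)=69$, and $\mathbb{E}(L_n)\to 69$ as $n\to\infty$ through the odd integers. -/

import Mathlib

open MeasureTheory ProbabilityTheory Filter Topology

namespace ParallelGW

/-- A rooted plane binary tree in which every node has zero or two children: `nil` is a leaf and
`node _ a b` is an internal node with left subtree `a` and right subtree `b`. -/
abbrev PlaneTree : Type := BinaryTree Unit

/-- The size of a tree: the number of all its nodes, leaves and internal nodes alike. -/
def size (T : PlaneTree) : ℕ := T.numNodes + T.numLeaves

/-- The set of all binary trees of size `n` (it is empty when `n` is even). -/
def treesOfSize (n : ℕ) : Set PlaneTree := {T | size T = n}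

instance : MeasurableSpace PlaneTree := ⊤

instance : DiscreteMeasurableSpace PlaneTree := ⟨fun _ => trivial⟩

/-- The two standard linear data structures: stacks (last in, first out) and queues
(first in, first out). A structure is stored as a list, and `pop` always removes the head. -/
inductive Discipline
  | stack
  | queue

/-- Push one element. -/
def push {α : Type} (d : Discipline) (l : List α) (x : α) : List α :=
  match d with
  | .stack => x :: l
  | .queue => l ++ [x]

/-- The memory of a thread: the linear data structures `lds₁` and `lds₂` of nodes that wait to be
processed. A waiting node is represented by the subtree that will be generated from it, so its
random bit is `1` when this subtree is a `node` and `0` when it is `nil`. -/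
structure Thread where
  lds₁ : List PlaneTree
  lds₂ : List PlaneTree

/-- Processing the node `T` that has just been popped, `s` being the memory after the pop. A leaf
adds nothing. The two children of an internal node are pushed into `lds₁` if `|lds₁| < t`, and
into `lds₂` otherwise; in the latter case, if now `|lds₂| ≥ t`, then `lds₂` is handed over to a
new thread and is replaced by an empty structure. -/
def process (d : Discipline) (t : ℕ) (T : PlaneTree) (s : Thread) : Thread :=
  match T with
  | .nil => s
  | .node _ a b =>
    if s.lds₁.length < t then
      ⟨push d (push d s.lds₁ a) b, s.lds₂⟩
    else
      if t ≤ (push d (push d s.lds₂ a) b).length then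
        ⟨s.lds₁, []⟩
      else
        ⟨s.lds₁, push d (push d s.lds₂ a) b⟩

/-- One iteration of the loop `while lds₁ is not empty`: a node is popped from `lds₂`, or from
`lds₁` if `lds₂` is empty, and is processed. (The value for empty `lds₁` is never used.) -/
def step (d : Discipline) (t : ℕ) : Thread → Thread
  | ⟨[], l₂⟩ => ⟨[], l₂⟩
  | ⟨T :: l₁, []⟩ => process d t T ⟨l₁, []⟩
  | ⟨T' :: l₁, T :: l₂⟩ => process d t T ⟨T' :: l₁, l₂⟩

/-- The total number of nodes of all the subtrees rooted at the waiting nodes of a thread. -/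
def pending (s : Thread) : ℕ := (s.lds₁.map size).sum + (s.lds₂.map size).sum

theorem sum_push (d : Discipline) (l : List PlaneTree) (T : PlaneTree) :
    ((push d l T).map size).sum = (l.map size).sum + size T := by
  cases d <;> simp [push, Nat.add_comm]

theorem pending_process_lt (d : Discipline) (t : ℕ) (T : PlaneTree) (s : Thread) :
    pending (process d t T s) < size T + pending s := by
  cases T with
  | nil => simp [process, size, pending]
  | node x a b =>
    have h : size (.node x a b) = size a + size b + 1 := by
      simp only [size, BinaryTree.numNodes, BinaryTree.numLeaves]; omega
    simp only [process]
    split_ifs <;> simp only [pending, sum_push, h, List.map_nil, List.sum_nil] <;> omega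

/-- Every iteration consumes at least one node, so each thread terminates. -/
theorem pending_step_lt (d : Discipline) (t : ℕ) (s : Thread) (hs : s.lds₁ ≠ []) :
    pending (step d t s) < pending s := by
  obtain ⟨l₁, l₂⟩ := s
  cases l₁ with
  | nil => exact absurd rfl hs
  | cons T l₁ =>
    cases l₂ with
    | nil =>
      refine lt_of_lt_of_eq (pending_process_lt d t T ⟨l₁, []⟩) ?_
      simp [pending]
    | cons T' l₂ =>
      refine lt_of_lt_of_eq (pending_process_lt d t T' ⟨T :: l₁, l₂⟩) ?_
      simp only [pending, List.map_cons, List.sum_cons]; omega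

/-- The number of iterations that a thread with memory `s` performs until `lds₁` is empty, that
is, the number of nodes that this thread processes itself. -/
def iterations (d : Discipline) (t : ℕ) (s : Thread) : ℕ :=
  if s.lds₁ = [] then 0 else iterations d t (step d t s) + 1
termination_by pending s
decreasing_by exact pending_step_lt d t s (by assumption)

/-- The lifetime of the first thread, with threshold `t`, in the execution that generates the
tree `T`: the first thread starts with `lds₁` containing the root only and `lds₂` empty. -/
def firstThreadLifetime (d : Discipline) (t : ℕ) (T : PlaneTree) : ℕ :=
  iterations d t ⟨[T], []⟩

/-- The uniform distribution on the binary trees of size `2 m + 1`, that is, with `m` internal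
nodes and `m + 1` leaves. -/
noncomputable def uniformTree (m : ℕ) : Measure PlaneTree := uniformOn (treesOfSize (2 * m + 1))

theorem treesOfSize_eq (m : ℕ) :
    treesOfSize (2 * m + 1) = (BinaryTree.treesOfNumNodesEq m : Set PlaneTree) := by
  ext T
  simp only [treesOfSize, size, BinaryTree.numLeaves_eq_numNodes_succ, Set.mem_ofPred_eq,
    SetLike.mem_coe, BinaryTree.mem_treesOfNumNodesEq]
  omega

instance (m : ℕ) : IsProbabilityMeasure (uniformTree m) := by
  unfold uniformTree
  rw [treesOfSize_eq]
  refine isProbabilityMeasure_uniformOn (Finset.finite_toSet _) ?_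
  rw [Finset.coe_nonempty, ← Finset.card_pos, BinaryTree.treesOfNumNodesEq_card_eq_catalan,
    catalan_eq_centralBinom_div]
  exact Nat.div_pos (Nat.le_of_dvd (Nat.centralBinom_pos m) (Nat.succ_dvd_centralBinom m))
    (Nat.succ_pos m)

end ParallelGW

/-!
Processing a node consumes one random bit, and the lengths `s = (|lds₁|, |lds₂|)` after a step
depend only on the lengths before it and on that bit. Pushing is a bijection for either discipline
(`tsum_forestSum_push`), so the number of trees with `m` internal nodes and lifetime `k` satisfies a
recursion in `k` on the lengths alone (`numConfigs`, `tsum_ind_firstThreadLifetime`): the popped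
tree is a leaf, or an internal node whose two subtrees are pushed or handed over. When the thread
has ended, what remains is a forest of `j` handed-over trees with the remaining `r` internal nodes,
and these are counted by ballot numbers (`numForests_mul_factorial`).

As `r → ∞`, the ratio of the number of forests of `j` trees to the Catalan number `Cᵣ` tends to
`j 2 ^ (j - 1)`, and `Cᵣ / Cᵣ₊₁` tends to `1 / 4`. Following the recursion, the probability that
the lifetime is `k` tends to `endHanded 4 k (1, 0)`, the expected number of handed-over nodes on the
event that the chain of lengths, driven by fair bits, ends after `k` steps
(`tendsto_numConfigs_div`).

For threshold four only nine states are reachable. The function `potential` contracts by a factor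
`36 / 37` in each step of the chain; together with the bound `j 2 ^ (j - 1) Cᵣ` for the number of
forests and the monotonicity of `(r + 1)² Cᵣ / 4 ^ r`, this bounds the law of the lifetime by a
polynomial times `(36 / 37) ^ k`, uniformly in `m` (`numConfigs_le`). Dominated convergence then
gives the convergence in distribution and that of the means (`tendsto_integral_lifetime`). The
generating function and the mean of the limit come from solving the linear system that the chain
imposes on the nine states (`handedTransform_pow`, `handedTransform_natCast`); the total mass of
the limit is the value of the generating function at `1`.
-/

namespace ParallelGW

open scoped ENNReal

/-! ### Sums over forests -/

/-- The sum of `φ` over all lists of `n` trees. -/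
noncomputable def forestSum : ℕ → (List PlaneTree → ℝ≥0∞) → ℝ≥0∞
  | 0, φ => φ []
  | n + 1, φ => ∑' T, forestSum n fun l => φ (T :: l)

theorem forestSum_congr {n : ℕ} {φ ψ : List PlaneTree → ℝ≥0∞}
    (h : ∀ l, l.length = n → φ l = ψ l) : forestSum n φ = forestSum n ψ := by
  induction n generalizing φ ψ with
  | zero => exact h [] rfl
  | succ n ih => exact tsum_congr fun T => ih fun l hl => h _ (by simp [hl])

theorem forestSum_tsum {ι : Type} (n : ℕ) (φ : ι → List PlaneTree → ℝ≥0∞) :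
    forestSum n (fun l => ∑' x, φ x l) = ∑' x, forestSum n (φ x) := by
  induction n generalizing φ with
  | zero => rfl
  | succ n ih =>
    simp only [forestSum, ih]
    exact ENNReal.tsum_comm

theorem forestSum_zero (n : ℕ) : forestSum n (fun _ => 0) = 0 := by
  induction n with
  | zero => rfl
  | succ n ih => simp [forestSum, ih]

theorem forestSum_append (m n : ℕ) (φ : List PlaneTree → ℝ≥0∞) :
    forestSum m (fun l => forestSum n fun l' => φ (l ++ l')) = forestSum (m + n) φ := by
  induction m generalizing φ with
  | zero => simp [forestSum]
  | succ m ih =>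
    rw [Nat.succ_add]
    exact tsum_congr fun T => ih fun l => φ (T :: l)

/-- Pushing a tree is a bijection from pairs (list of `n` trees, tree) to lists of `n + 1` trees,
whatever the discipline. This is why the law of the lifetime does not depend on the discipline. -/
theorem tsum_forestSum_push (d : Discipline) (n : ℕ) (φ : List PlaneTree → ℝ≥0∞) :
    ∑' T, forestSum n (fun l => φ (push d l T)) = forestSum (n + 1) φ := by
  cases d with
  | stack => rfl
  | queue =>
    induction n generalizing φ with
    | zero => rfl
    | succ n ih =>
      simp only [forestSum, push, List.cons_append] at ih ⊢
      rw [ENNReal.tsum_comm]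
      exact tsum_congr fun T => ih fun l => φ (T :: l)

theorem tsum_forestSum_push_push (d : Discipline) (n : ℕ) (φ : List PlaneTree → ℝ≥0∞) :
    ∑' (a : PlaneTree) (b : PlaneTree), forestSum n (fun l => φ (push d (push d l a) b)) =
      forestSum (n + 2) φ := by
  rw [ENNReal.tsum_comm, ← tsum_forestSum_push d]
  exact tsum_congr fun b => tsum_forestSum_push d n fun l => φ (push d l b)

/-- A tree is a leaf, or an internal node with two subtrees. -/
theorem tsum_planeTree (φ : PlaneTree → ℝ≥0∞) :
    ∑' T, φ T = φ .nil + ∑' (a : PlaneTree) (b : PlaneTree), φ (.node () a b) := by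
  let e : Unit ⊕ (PlaneTree × PlaneTree) ≃ PlaneTree :=
    { toFun := Sum.elim (fun _ => .nil) fun p => .node () p.1 p.2
      invFun := fun T => match T with
        | .nil => .inl ()
        | .node _ a b => .inr (a, b)
      left_inv := by rintro (_ | ⟨a, b⟩) <;> rfl
      right_inv := by rintro (_ | ⟨_, a, b⟩) <;> rfl }
  rw [← e.tsum_eq, ENNReal.summable.tsum_sum ENNReal.summable, tsum_fintype, ENNReal.tsum_prod']
  simp [e]

/-- The total number of internal nodes of a forest. -/
def forestNodes (l : List PlaneTree) : ℕ := (l.map BinaryTree.numNodes).sum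

theorem forestNodes_nil : forestNodes [] = 0 := rfl

theorem forestNodes_cons (T : PlaneTree) (l : List PlaneTree) :
    forestNodes (T :: l) = T.numNodes + forestNodes l := by simp [forestNodes]

theorem forestNodes_append (l l' : List PlaneTree) :
    forestNodes (l ++ l') = forestNodes l + forestNodes l' := by simp [forestNodes]

theorem forestNodes_push (d : Discipline) (l : List PlaneTree) (T : PlaneTree) :
    forestNodes (push d l T) = forestNodes l + T.numNodes := by
  cases d <;> simp [push, forestNodes, Nat.add_comm]

theorem length_push (d : Discipline) (l : List PlaneTree) (T : PlaneTree) :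
    (push d l T).length = l.length + 1 := by
  cases d <;> simp [push]

/-- The indicator of a proposition. -/
noncomputable def ind (P : Prop) : ℝ≥0∞ := open Classical in if P then 1 else 0

theorem ind_congr {P Q : Prop} (h : P ↔ Q) : ind P = ind Q := by rw [propext h]

theorem ind_false {P : Prop} (h : ¬P) : ind P = 0 := by simp [ind, h]

/-! ### The number of forests -/

/-- The number of forests of `j` binary trees with `r` internal nodes in total. The recursion
distinguishes whether the first tree is a leaf or an internal node with two subtrees. -/
def numForests : ℕ → ℕ → ℕ
  | 0, 0 => 1
  | _ + 1, 0 => 1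
  | 0, _ + 1 => 0
  | j + 1, r + 1 => numForests j (r + 1) + numForests (j + 2) r
termination_by j r => (r, j)

theorem numForests_zero_right (j : ℕ) : numForests j 0 = 1 := by cases j <;> simp [numForests]

theorem numForests_zero_succ (r : ℕ) : numForests 0 (r + 1) = 0 := by simp [numForests]

theorem numForests_succ_succ (j r : ℕ) :
    numForests (j + 1) (r + 1) = numForests j (r + 1) + numForests (j + 2) r := by
  rw [numForests]

theorem forestSum_ind_forestNodes (j r : ℕ) :
    forestSum j (fun l => ind (forestNodes l = r)) = numForests j r := by
  induction r generalizing j with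
  | zero =>
    induction j with
    | zero => simp [forestSum, forestNodes, ind, numForests]
    | succ j ih =>
      rw [forestSum, tsum_planeTree]
      simp only [forestNodes_cons, BinaryTree.numNodes, zero_add, ih]
      have h0 : ∀ a b : PlaneTree, forestSum j (fun l =>
          ind (a.numNodes + b.numNodes + 1 + forestNodes l = 0)) = 0 := fun a b => by
        rw [← forestSum_zero j]
        exact forestSum_congr fun l _ => ind_false (by omega)
      simp only [h0, tsum_zero, add_zero, numForests_zero_right]
  | succ r ihr =>
    induction j with
    | zero => simp [forestSum, forestNodes, ind, numForests]
    | succ j ih =>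
      rw [forestSum, tsum_planeTree]
      simp only [forestNodes_cons, BinaryTree.numNodes, zero_add, ih]
      rw [numForests_succ_succ, Nat.cast_add, ← ihr]
      congr 1
      refine tsum_congr fun a => tsum_congr fun b => forestSum_congr fun l _ => ind_congr ?_
      simp only [forestNodes_cons]
      omega

/-- The ballot formula. -/
theorem numForests_mul_factorial (j r : ℕ) :
    numForests (j + 1) r * (r.factorial * (r + j + 1).factorial) =
      (j + 1) * (2 * r + j).factorial := by
  induction r generalizing j with
  | zero => simp [numForests_zero_right, Nat.factorial_succ]
  | succ r ihr =>
    induction j with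
    | zero =>
      have h := ihr 1
      rw [numForests_succ_succ, numForests_zero_succ]
      simp only [zero_add] at h ⊢
      have e1 : (r + 1).factorial = (r + 1) * r.factorial := Nat.factorial_succ r
      have e2 : 2 * (r + 1) + 0 = (2 * r + 1) + 1 := by ring
      rw [e2, Nat.factorial_succ (2 * r + 1), e1]
      have e3 : r + 1 + 1 = r + 1 + 0 + 1 := by ring
      simp only [add_zero]
      linear_combination (r + 1) * h
    | succ j ih =>
      have h := ihr (j + 2)
      rw [numForests_succ_succ]
      have e1 : (r + 1 + (j + 1) + 1).factorial =
        (r + j + 3) * (r + 1 + j + 1).factorial := by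
        rw [show r + 1 + (j + 1) + 1 = (r + 1 + j + 1) + 1 by ring, Nat.factorial_succ]
        ring
      have e2 : (2 * (r + 1) + (j + 1)).factorial =
        (2 * r + j + 3) * (2 * (r + 1) + j).factorial := by
        rw [show 2 * (r + 1) + (j + 1) = (2 * (r + 1) + j) + 1 by ring, Nat.factorial_succ]
        ring
      have e3 : (r + 1).factorial = (r + 1) * r.factorial := Nat.factorial_succ r
      have e4 : (r + (j + 2) + 1).factorial = (r + j + 3) * (r + 1 + j + 1).factorial := by
        rw [← e1]; congr 1; ring
      rw [show 2 * r + (j + 2) = 2 * (r + 1) + j by ring, e4] at h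
      rw [e1, e2]
      rw [e3] at ih ⊢
      linear_combination (r + j + 3) * ih + (r + 1) * h

theorem numForests_pos (j r : ℕ) : 0 < numForests (j + 1) r := by
  have h := numForests_mul_factorial j r
  refine Nat.pos_of_ne_zero fun h0 => ?_
  rw [h0, zero_mul] at h
  have := Nat.factorial_pos (2 * r + j)
  exact absurd h.symm (by positivity)

theorem numForests_ratio (j r : ℕ) :
    numForests (j + 2) r * ((j + 1) * (r + j + 2)) =
      numForests (j + 1) r * ((j + 2) * (2 * r + j + 1)) := by
  have h1 := numForests_mul_factorial j r
  have h2 := numForests_mul_factorial (j + 1) r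
  have e1 : (r + (j + 1) + 1).factorial = (r + j + 2) * (r + j + 1).factorial := by
    rw [show r + (j + 1) + 1 = (r + j + 1) + 1 by ring, Nat.factorial_succ]
  have e2 : (2 * r + (j + 1)).factorial = (2 * r + j + 1) * (2 * r + j).factorial := by
    rw [show 2 * r + (j + 1) = (2 * r + j) + 1 by ring, Nat.factorial_succ]
  rw [e1, e2] at h2
  have hp : 0 < r.factorial * (r + j + 1).factorial := by positivity
  refine Nat.eq_of_mul_eq_mul_right hp ?_
  linear_combination (j + 1) * h2 - (j + 2) * (2 * r + j + 1) * h1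

/-- The ratio of consecutive Catalan numbers. -/
theorem numForests_one_ratio (r : ℕ) :
    numForests 1 (r + 1) * (r + 2) = numForests 1 r * (2 * (2 * r + 1)) := by
  have h := numForests_ratio 0 r
  rw [numForests_succ_succ, numForests_zero_succ]
  simp only [zero_add] at h ⊢
  linarith

/-! ### Executions as a chain on the lengths of the two structures -/

/-- The lengths `(|lds₁|, |lds₂|)` after a pop. -/
def popped : ℕ × ℕ → ℕ × ℕ
  | (i, 0) => (i - 1, 0)
  | (i, q + 1) => (i, q)

/-- The lengths after a pop whose node turns out to be internal. -/
def branched (t : ℕ) (s : ℕ × ℕ) : ℕ × ℕ :=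
  if (popped s).1 < t then ((popped s).1 + 2, (popped s).2)
  else if t ≤ (popped s).2 + 2 then ((popped s).1, 0)
  else ((popped s).1, (popped s).2 + 2)

/-- The number of nodes handed over to a new thread after the pop of an internal node. -/
def handed (t : ℕ) (s : ℕ × ℕ) : ℕ :=
  if (popped s).1 < t then 0 else if t ≤ (popped s).2 + 2 then (popped s).2 + 2 else 0

/-- The number of configurations with `r` internal nodes in total in which the two structures of a
thread have lengths `s`, `j` further trees belong to other threads, and the thread processes
exactly `k` nodes until it ends. -/
def numConfigs (t : ℕ) : ℕ → ℕ × ℕ → ℕ → ℕ → ℕ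
  | 0, s, j, r => if s.1 = 0 then numForests (s.2 + j) r else 0
  | k + 1, s, j, r =>
    if s.1 = 0 then 0
    else numConfigs t k (popped s) j r +
      match r with
      | 0 => 0
      | r + 1 => numConfigs t k (branched t s) (j + handed t s) r

theorem numConfigs_zero (t : ℕ) (s : ℕ × ℕ) (j r : ℕ) :
    numConfigs t 0 s j r = if s.1 = 0 then numForests (s.2 + j) r else 0 := rfl

theorem numConfigs_succ_zero (t k : ℕ) (s : ℕ × ℕ) (j : ℕ) :
    numConfigs t (k + 1) s j 0 = if s.1 = 0 then 0 else numConfigs t k (popped s) j 0 := rfl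

theorem numConfigs_succ_succ (t k : ℕ) (s : ℕ × ℕ) (j r : ℕ) :
    numConfigs t (k + 1) s j (r + 1) = if s.1 = 0 then 0 else
      numConfigs t k (popped s) j (r + 1) +
        numConfigs t k (branched t s) (j + handed t s) r := rfl

/-- The sum over configurations that `numConfigs` evaluates. -/
noncomputable def configSum (d : Discipline) (t k : ℕ) (s : ℕ × ℕ) (j r : ℕ) : ℝ≥0∞ :=
  forestSum s.1 fun l₁ => forestSum s.2 fun l₂ => forestSum j fun l₃ =>
    ind (iterations d t ⟨l₁, l₂⟩ = k ∧ forestNodes l₁ + forestNodes l₂ + forestNodes l₃ = r)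

theorem iterations_nil (d : Discipline) (t : ℕ) (l₂ : List PlaneTree) :
    iterations d t ⟨[], l₂⟩ = 0 := by
  rw [iterations]; simp

theorem iterations_cons (d : Discipline) (t : ℕ) (T : PlaneTree) (l₁ l₂ : List PlaneTree) :
    iterations d t ⟨T :: l₁, l₂⟩ = iterations d t (step d t ⟨T :: l₁, l₂⟩) + 1 := by
  rw [iterations]; simp

/-- Isolates the tree `T` that is popped first. -/
theorem configSum_succ_eq_tsum (d : Discipline) (t k : ℕ) (s : ℕ × ℕ) (hs : s.1 ≠ 0) (j r : ℕ) :
    configSum d t (k + 1) s j r = ∑' T : PlaneTree, forestSum (popped s).1 fun l₁ =>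
      forestSum (popped s).2 fun l₂ => forestSum j fun l₃ =>
        ind (iterations d t (process d t T ⟨l₁, l₂⟩) = k ∧
          T.numNodes + (forestNodes l₁ + forestNodes l₂ + forestNodes l₃) = r) := by
  obtain ⟨_ | i, q⟩ := s
  · exact absurd rfl hs
  symm
  cases q with
  | zero =>
    refine tsum_congr fun T => forestSum_congr fun l₁ _ => forestSum_congr fun l₂ h₂ =>
      forestSum_congr fun l₃ _ => ind_congr ?_
    obtain rfl := List.eq_nil_of_length_eq_zero h₂
    simp only [iterations_cons, step, forestNodes_cons, Nat.add_right_cancel_iff, add_assoc]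
  | succ q =>
    refine (forestSum_tsum _ _).symm.trans (forestSum_congr fun l₁ h₁ => ?_)
    refine tsum_congr fun T => forestSum_congr fun l₂ _ => forestSum_congr fun l₃ _ =>
      ind_congr ?_
    obtain ⟨T', l, rfl⟩ := List.exists_cons_of_length_eq_add_one h₁
    simp only [iterations_cons, step, forestNodes_cons, Nat.add_right_cancel_iff]
    refine and_congr_right fun _ => ?_
    omega

/-- The contribution of the configurations in which an internal node with subtrees `a` and `b` is
popped first, that node itself not being counted in `r`. The three cases are those of `process`;
trees handed over join the `j` trees of other threads. -/
theorem configSum_branched (d : Discipline) (t k : ℕ) (s : ℕ × ℕ) (j r : ℕ) :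
    (∑' (a : PlaneTree) (b : PlaneTree), forestSum (popped s).1 fun l₁ =>
      forestSum (popped s).2 fun l₂ => forestSum j fun l₃ =>
        ind (iterations d t (process d t (.node () a b) ⟨l₁, l₂⟩) = k ∧
          a.numNodes + b.numNodes + (forestNodes l₁ + forestNodes l₂ + forestNodes l₃) = r)) =
      configSum d t k (branched t s) (j + handed t s) r := by
  unfold branched handed
  obtain ⟨i, q⟩ := popped s
  dsimp only
  split_ifs with hi hq
  · refine Eq.trans ?_ (tsum_forestSum_push_push d i _)
    refine tsum_congr fun a => tsum_congr fun b => forestSum_congr fun l₁ h₁ =>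
      forestSum_congr fun l₂ _ => forestSum_congr fun l₃ _ => ind_congr ?_
    simp only [process, h₁, hi, if_true, forestNodes_push]
    refine and_congr_right fun _ => ?_
    omega
  · simp_rw [← forestSum_tsum]
    refine forestSum_congr fun l₁ h₁ => ?_
    refine Eq.trans (b := forestSum (q + 2) fun l₂ => forestSum j fun l₃ =>
      ind (iterations d t ⟨l₁, []⟩ = k ∧ forestNodes l₁ + forestNodes (l₂ ++ l₃) = r)) ?_ ?_
    · simp_rw [forestSum_tsum]
      refine Eq.trans ?_ (tsum_forestSum_push_push d q _)
      refine tsum_congr fun a => tsum_congr fun b =>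
        forestSum_congr fun l₂ h₂ => forestSum_congr fun l₃ _ => ind_congr ?_
      simp only [process, h₁, h₂, hi, hq, if_true, if_false, length_push, forestNodes_append,
        forestNodes_push]
      refine and_congr_right fun _ => ?_
      omega
    · rw [forestSum_append (q + 2) j fun l =>
        ind (iterations d t ⟨l₁, []⟩ = k ∧ forestNodes l₁ + forestNodes l = r), add_comm j]
      simp only [forestSum, forestNodes_nil, add_zero]
  · simp_rw [← forestSum_tsum]
    refine forestSum_congr fun l₁ h₁ => ?_
    simp_rw [forestSum_tsum]
    refine Eq.trans ?_ (tsum_forestSum_push_push d q _)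
    refine tsum_congr fun a => tsum_congr fun b =>
      forestSum_congr fun l₂ h₂ => forestSum_congr fun l₃ _ => ind_congr ?_
    simp only [process, h₁, h₂, hi, hq, if_false, length_push, forestNodes_push]
    refine and_congr_right fun _ => ?_
    omega

/-- The number of configurations depends on the lengths only, and not on the discipline. -/
theorem configSum_eq (d : Discipline) (t k : ℕ) (s : ℕ × ℕ) (j r : ℕ) :
    configSum d t k s j r = numConfigs t k s j r := by
  induction k generalizing s j r with
  | zero =>
    rw [numConfigs_zero]
    split_ifs with hs
    · rw [← forestSum_ind_forestNodes, ← forestSum_append, configSum, hs]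
      refine forestSum_congr fun l₂ _ => forestSum_congr fun l₃ _ => ind_congr ?_
      simp [iterations_nil, forestNodes_nil, forestNodes_append]
    · rw [configSum, Nat.cast_zero, ← forestSum_zero s.1]
      refine forestSum_congr fun l₁ h₁ => ?_
      obtain ⟨T, l, rfl⟩ := List.exists_cons_of_ne_nil (List.ne_nil_of_length_pos
        (h₁ ▸ Nat.pos_of_ne_zero hs))
      rw [← forestSum_zero s.2]
      refine forestSum_congr fun l₂ _ => ?_
      rw [← forestSum_zero j]
      exact forestSum_congr fun l₃ _ => ind_false (by simp [iterations_cons])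
  | succ k ih =>
    by_cases hs : s.1 = 0
    · have h0 : configSum d t (k + 1) s j r = 0 := by
        rw [configSum, hs, forestSum, ← forestSum_zero s.2]
        refine forestSum_congr fun l₂ _ => ?_
        rw [← forestSum_zero j]
        exact forestSum_congr fun l₃ _ => ind_false (by simp [iterations_nil])
      cases r <;> simp [h0, hs, numConfigs_succ_zero, numConfigs_succ_succ]
    · rw [configSum_succ_eq_tsum d t k s hs, tsum_planeTree]
      have hnil : (forestSum (popped s).1 fun l₁ => forestSum (popped s).2 fun l₂ =>
          forestSum j fun l₃ => ind (iterations d t (process d t .nil ⟨l₁, l₂⟩) = k ∧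
            BinaryTree.numNodes (.nil : PlaneTree) +
              (forestNodes l₁ + forestNodes l₂ + forestNodes l₃) = r)) =
          numConfigs t k (popped s) j r := by
        rw [← ih]
        simp only [BinaryTree.numNodes, zero_add, process]
        rfl
      rw [hnil]
      cases r with
      | zero =>
        rw [numConfigs_succ_zero, if_neg hs]
        refine (congrArg _ ?_).trans (add_zero _)
        simp only [ENNReal.tsum_eq_zero]
        intro a b
        rw [← forestSum_zero (popped s).1]
        refine forestSum_congr fun l₁ _ => ?_
        rw [← forestSum_zero (popped s).2]
        refine forestSum_congr fun l₂ _ => ?_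
        rw [← forestSum_zero j]
        refine forestSum_congr fun l₃ _ => ind_false ?_
        simp only [BinaryTree.numNodes]
        omega
      | succ r =>
        rw [numConfigs_succ_succ, if_neg hs, Nat.cast_add, ← ih (branched t s),
          ← configSum_branched]
        congr 1
        refine tsum_congr fun a => tsum_congr fun b => forestSum_congr fun l₁ _ =>
          forestSum_congr fun l₂ _ => forestSum_congr fun l₃ _ => ind_congr ?_
        refine and_congr_right fun _ => ?_
        simp only [BinaryTree.numNodes]
        omega

/-- The number of trees with `m` internal nodes and lifetime `k`. -/
theorem tsum_ind_firstThreadLifetime (d : Discipline) (t k m : ℕ) :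
    ∑' T : PlaneTree, ind (firstThreadLifetime d t T = k ∧ T.numNodes = m) =
      numConfigs t k (1, 0) 0 m := by
  rw [← configSum_eq d]
  refine tsum_congr fun T => ?_
  simp [forestSum, firstThreadLifetime, forestNodes]

/-! ### The limit of the number of configurations -/

theorem tendsto_numForests_one_ratio :
    Tendsto (fun r => (numForests 1 r : ℝ) / numForests 1 (r + 1)) atTop (𝓝 (1 / 4)) := by
  have h : ∀ r : ℕ, (numForests 1 r : ℝ) / numForests 1 (r + 1) =
      1 / 4 + 3 / 8 * (1 / ((r : ℝ) + 1 / 2)) := fun r => by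
    have h1 : (numForests 1 (r + 1) : ℝ) * (r + 2) = numForests 1 r * (2 * (2 * r + 1)) := by
      exact_mod_cast numForests_one_ratio r
    have h2 : (numForests 1 (r + 1) : ℝ) ≠ 0 := by exact_mod_cast (numForests_pos 0 (r + 1)).ne'
    have h3 : (r : ℝ) + 1 / 2 ≠ 0 := by positivity
    rw [div_eq_iff h2]
    field_simp
    linear_combination -16 * h1
  simp_rw [h]
  have h4 : Tendsto (fun r : ℕ => 1 / ((r : ℝ) + 1 / 2)) atTop (𝓝 0) :=
    tendsto_const_nhds.div_atTop (tendsto_atTop_add_const_right _ _ tendsto_natCast_atTop_atTop)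
  simpa using (h4.const_mul (3 / 8)).const_add (1 / 4 : ℝ)

theorem tendsto_numForests_div (j : ℕ) :
    Tendsto (fun r => (numForests j r : ℝ) / numForests 1 r) atTop (𝓝 (2 ^ j / 2 * j)) := by
  induction j with
  | zero =>
    rw [← tendsto_add_atTop_iff_nat 1]
    simp [numForests_zero_succ]
  | succ j ih =>
    cases j with
    | zero =>
      have h : ∀ r, (numForests 1 r : ℝ) / numForests 1 r = 1 := fun r =>
        div_self (by exact_mod_cast (numForests_pos 0 r).ne')
      simp [h]
    | succ j =>
      have h : ∀ r : ℕ, (numForests (j + 1 + 1) r : ℝ) / numForests 1 r =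
          numForests (j + 1) r / numForests 1 r *
            (((j : ℝ) + 2) / (j + 1) * (2 - ((j : ℝ) + 3) * (1 / ((r : ℝ) + (j + 2))))) := by
        intro r
        have h1 : (numForests (j + 2) r : ℝ) * ((j + 1) * (r + j + 2)) =
            numForests (j + 1) r * ((j + 2) * (2 * r + j + 1)) := by
          exact_mod_cast numForests_ratio j r
        have h2 : (numForests 1 r : ℝ) ≠ 0 := by exact_mod_cast (numForests_pos 0 r).ne'
        have h3 : (r : ℝ) + (j + 2) ≠ 0 := by positivity
        have h4 : (j : ℝ) + 1 ≠ 0 := by positivity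
        field_simp
        linear_combination h1
      simp_rw [h]
      have h4 : Tendsto (fun r : ℕ => 1 / ((r : ℝ) + (j + 2))) atTop (𝓝 0) :=
        tendsto_const_nhds.div_atTop
          (tendsto_atTop_add_const_right _ _ tendsto_natCast_atTop_atTop)
      have h5 : (j : ℝ) + 1 ≠ 0 := by positivity
      convert ih.mul (((h4.const_mul ((j : ℝ) + 3)).const_sub 2).const_mul
        (((j : ℝ) + 2) / (j + 1))) using 2
      push_cast
      field_simp
      ring

/-- The probability that the chain of lengths, each node being a leaf or internal with
probability one half, ends after exactly `k` steps when started at `s`. -/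
noncomputable def endProb (t : ℕ) : ℕ → ℕ × ℕ → ℝ
  | 0, s => if s.1 = 0 then 1 else 0
  | k + 1, s =>
    if s.1 = 0 then 0 else (endProb t k (popped s) + endProb t k (branched t s)) / 2

/-- The expectation of the number of nodes handed over, on the event that the chain of lengths
started at `s` ends after exactly `k` steps. Nodes that are left in `lds₂` at the end count as
handed over; there are none in an execution. -/
noncomputable def endHanded (t : ℕ) : ℕ → ℕ × ℕ → ℝ
  | 0, s => if s.1 = 0 then s.2 else 0
  | k + 1, s =>
    if s.1 = 0 then 0
    else (endHanded t k (popped s) + endHanded t k (branched t s) +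
      handed t s * endProb t k (branched t s)) / 2

theorem popped_add (s : ℕ × ℕ) (hs : s.1 ≠ 0) :
    (popped s).1 + (popped s).2 + 1 = s.1 + s.2 := by
  obtain ⟨i, _ | q⟩ := s <;> simp only [popped] at hs ⊢ <;> omega

theorem branched_add (t : ℕ) (s : ℕ × ℕ) (hs : s.1 ≠ 0) :
    (branched t s).1 + (branched t s).2 + handed t s = s.1 + s.2 + 1 := by
  have := popped_add s hs
  unfold branched handed
  split_ifs <;> dsimp only <;> omega

/-- The factor `2 ^ (s.1 + s.2 + j) / 2` turns the recursion for `numConfigs` into the one with fair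
bits: a leaf removes one waiting tree, and an internal node adds one at the price of one internal
node, hence of a factor `1 / 4`. -/
theorem tendsto_numConfigs_div (t k : ℕ) (s : ℕ × ℕ) (j : ℕ) :
    Tendsto (fun r => (numConfigs t k s j r : ℝ) / numForests 1 r) atTop
      (𝓝 (2 ^ (s.1 + s.2 + j) / 2 * (j * endProb t k s + endHanded t k s))) := by
  induction k generalizing s j with
  | zero =>
    simp only [numConfigs_zero, endProb, endHanded]
    split_ifs with hs
    · convert tendsto_numForests_div (s.2 + j) using 2
      rw [hs]
      push_cast
      ring
    · simp
  | succ k ih =>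
    rw [← tendsto_add_atTop_iff_nat 1]
    simp only [numConfigs_succ_succ, endProb, endHanded]
    split_ifs with hs
    · simp
    · have h : ∀ r : ℕ, ((numConfigs t k (popped s) j (r + 1) +
          numConfigs t k (branched t s) (j + handed t s) r : ℕ) : ℝ) / numForests 1 (r + 1) =
          numConfigs t k (popped s) j (r + 1) / numForests 1 (r + 1) +
          numConfigs t k (branched t s) (j + handed t s) r / numForests 1 r *
            (numForests 1 r / numForests 1 (r + 1)) := fun r => by
        have h2 : (numForests 1 r : ℝ) ≠ 0 := by exact_mod_cast (numForests_pos 0 r).ne'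
        have h3 : (numForests 1 (r + 1) : ℝ) ≠ 0 := by
          exact_mod_cast (numForests_pos 0 (r + 1)).ne'
        push_cast
        field_simp
      simp_rw [h]
      convert ((tendsto_add_atTop_iff_nat 1).2 (ih (popped s) j)).add
        ((ih (branched t s) (j + handed t s)).mul tendsto_numForests_one_ratio) using 2
      have e1 : s.1 + s.2 + j = (popped s).1 + (popped s).2 + j + 1 := by
        have := popped_add s hs
        omega
      have e2 : (branched t s).1 + (branched t s).2 + (j + handed t s) =
          (popped s).1 + (popped s).2 + j + 1 + 1 := by
        have := branched_add t s hs
        have := popped_add s hs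
        omega
      rw [e1, e2]
      push_cast
      ring

/-! ### Domination for threshold four -/

theorem numForests_succ_le (j r : ℕ) :
    (numForests (j + 1) r : ℝ) ≤ 2 ^ j * (j + 1) * numForests 1 r := by
  induction j with
  | zero => simp
  | succ j ih =>
    have h1 : (numForests (j + 2) r : ℝ) * ((j + 1) * (r + j + 2)) =
        numForests (j + 1) r * ((j + 2) * (2 * r + j + 1)) := by
      exact_mod_cast numForests_ratio j r
    have h2 : (0 : ℝ) < (j + 1) * (r + j + 2) := by positivity
    refine le_of_mul_le_mul_right ?_ h2
    rw [h1]
    calc (numForests (j + 1) r : ℝ) * ((j + 2) * (2 * r + j + 1))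
        ≤ (2 ^ j * (j + 1) * numForests 1 r) * ((j + 2) * (2 * (r + j + 2))) := by
          gcongr
          linarith
      _ = _ := by push_cast; ring

/-- A form of `numForests_succ_le` that is also valid for the empty forest. -/
theorem numForests_le (j r : ℕ) :
    (numForests j r : ℝ) ≤ 2 ^ j / 2 * (j + 2) * numForests 1 r := by
  cases j with
  | zero =>
    cases r with
    | zero => simp [numForests_zero_right]
    | succ r => simp [numForests_zero_succ]
  | succ j =>
    refine (numForests_succ_le j r).trans ?_
    rw [pow_succ, mul_div_cancel_right₀ _ two_ne_zero]
    have h : ((j : ℝ) + 1) ≤ (j + 1 : ℕ) + 2 := by push_cast; linarith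
    gcongr

/-- The sequence `(r + 1)² Cᵣ / 4ʳ` is monotone, where `Cᵣ` is the Catalan number. -/
theorem monotone_numForests_one :
    Monotone fun r : ℕ => ((r : ℝ) + 1) ^ 2 * (numForests 1 r / 4 ^ r) := by
  refine monotone_nat_of_le_succ fun r => ?_
  have h1 : (numForests 1 (r + 1) : ℝ) = numForests 1 r * (2 * (2 * r + 1)) / (r + 2) := by
    rw [eq_div_iff (by positivity)]
    exact_mod_cast numForests_one_ratio r
  rw [h1, pow_succ (4 : ℝ)]
  push_cast
  have h2 : ((r : ℝ) + 1 + 1) ^ 2 * (numForests 1 r * (2 * (2 * r + 1)) / (r + 2) / (4 ^ r * 4)) =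
      (r + 2) * (2 * r + 1) / 2 * (numForests 1 r / 4 ^ r) := by
    field_simp
    ring
  rw [h2]
  gcongr
  nlinarith [(Nat.cast_nonneg r : (0 : ℝ) ≤ r)]

theorem numForests_one_div_le {r m : ℕ} (h : r ≤ m) :
    (numForests 1 r : ℝ) / 4 ^ r ≤ ((m : ℝ) - r + 1) ^ 2 * (numForests 1 m / 4 ^ m) := by
  have h1 : ((r : ℝ) + 1) ^ 2 * (numForests 1 r / 4 ^ r) ≤
    ((m : ℝ) + 1) ^ 2 * (numForests 1 m / 4 ^ m) := monotone_numForests_one h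
  have h2 : (0 : ℝ) < ((r : ℝ) + 1) ^ 2 := by positivity
  refine le_of_mul_le_mul_left (h1.trans ?_) h2
  rw [← mul_assoc, ← mul_pow]
  have h3 : (r : ℝ) ≤ m := by exact_mod_cast h
  have h4 : (0 : ℝ) ≤ r := Nat.cast_nonneg r
  gcongr
  nlinarith

/-- The states that the chain of lengths with threshold four can reach from `(1, 0)`. -/
def Reachable (s : ℕ × ℕ) : Prop := s.2 = 0 ∧ s.1 ≤ 5 ∨ s.1 = 4 ∧ s.2 ≤ 3

theorem Reachable.cases {s : ℕ × ℕ} (h : Reachable s) :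
    s = (0, 0) ∨ s = (1, 0) ∨ s = (2, 0) ∨ s = (3, 0) ∨ s = (4, 0) ∨ s = (5, 0) ∨
      s = (4, 1) ∨ s = (4, 2) ∨ s = (4, 3) := by
  obtain ⟨i, q⟩ := s
  simp only [Reachable, Prod.mk.injEq] at h ⊢
  omega

theorem reachable_popped {s : ℕ × ℕ} (h : Reachable s) : Reachable (popped s) := by
  rcases h.cases with rfl | rfl | rfl | rfl | rfl | rfl | rfl | rfl | rfl <;>
    simp [Reachable, popped]

theorem reachable_branched {s : ℕ × ℕ} (h : Reachable s) (hs : s.1 ≠ 0) :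
    Reachable (branched 4 s) := by
  rcases h.cases with rfl | rfl | rfl | rfl | rfl | rfl | rfl | rfl | rfl <;>
    first
    | exact absurd rfl hs
    | simp [Reachable, popped, branched]

theorem handed_le (s : ℕ × ℕ) (h : Reachable s) : handed 4 s ≤ 4 := by
  rcases h.cases with rfl | rfl | rfl | rfl | rfl | rfl | rfl | rfl | rfl <;>
    simp [popped, handed]

/-- For a reachable state, one more than the expected time until the chain of lengths with threshold
four ends. -/
def potential (s : ℕ × ℕ) : ℝ := 1 + s.1 * (12 - s.1) + s.2 * (4 - s.2)

theorem one_le_potential {s : ℕ × ℕ} (h : Reachable s) : 1 ≤ potential s := by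
  rcases h.cases with rfl | rfl | rfl | rfl | rfl | rfl | rfl | rfl | rfl <;>
    norm_num [potential]

/-- The expected potential drops by one in each step, hence by a factor `36 / 37` as the
potential is at most `37`. -/
theorem potential_step {s : ℕ × ℕ} (h : Reachable s) (hs : s.1 ≠ 0) :
    (potential (popped s) + potential (branched 4 s)) / 2 ≤ 36 / 37 * potential s := by
  rcases h.cases with rfl | rfl | rfl | rfl | rfl | rfl | rfl | rfl | rfl <;>
    first
    | exact absurd rfl hs
    | norm_num [potential, popped, branched]

/-- Domination: the three factors that depend on `k` bound the number of trees handed over, the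
probability that the chain ends after `k` steps, and the ratio of the normalised Catalan numbers
of indices at least `r - k` and `m`. -/
theorem numConfigs_le (m k : ℕ) {s : ℕ × ℕ} (h : Reachable s) (j r : ℕ) (hr : r ≤ m) :
    (numConfigs 4 k s j r : ℝ) ≤ 4 ^ r * (2 ^ (s.1 + s.2 + j) / 2) * ((j + 4 * k + 2) *
      (potential s * (36 / 37) ^ k) * ((m : ℝ) - r + k + 1) ^ 2) * (numForests 1 m / 4 ^ m) := by
  induction k generalizing s j r with
  | zero =>
    have hp := one_le_potential h
    rw [numConfigs_zero]
    split_ifs with hs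
    · have hq : s.2 = 0 := by unfold Reachable at h; omega
      have h1 := numForests_one_div_le hr
      rw [div_le_iff₀ (by positivity)] at h1
      rw [hs, hq]
      calc (numForests (0 + j) r : ℝ) ≤ 2 ^ j / 2 * (j + 2) * numForests 1 r := by
            rw [zero_add]; exact numForests_le j r
        _ ≤ 2 ^ j / 2 * ((j + 2) * potential s) *
            (((m : ℝ) - r + 1) ^ 2 * (numForests 1 m / 4 ^ m) * 4 ^ r) := by
          gcongr
          exact le_mul_of_one_le_right (by positivity) hp
        _ = _ := by simp; ring
    · simp only [Nat.cast_zero]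
      positivity
  | succ k ih =>
    have hp := one_le_potential h
    have hm : (0 : ℝ) ≤ (m : ℝ) - r := sub_nonneg.2 (by exact_mod_cast hr)
    by_cases hs : s.1 = 0
    · have h0 : numConfigs 4 (k + 1) s j r = 0 := by
        cases r <;> simp [hs, numConfigs_succ_zero, numConfigs_succ_succ]
      rw [h0, Nat.cast_zero]
      positivity
    · set P : ℝ := 2 ^ ((popped s).1 + (popped s).2 + j) with hP
      set C : ℝ := (j + 4 * (k + 1 : ℕ) + 2) * (36 / 37) ^ k *
        ((m : ℝ) - r + (k + 1 : ℕ) + 1) ^ 2 * (numForests 1 m / 4 ^ m) with hC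
      have e1 : (2 : ℝ) ^ (s.1 + s.2 + j) = 2 * P := by
        have := popped_add s hs
        rw [hP, ← pow_succ']
        congr 1
        omega
      have e2 : (2 : ℝ) ^ ((branched 4 s).1 + (branched 4 s).2 + (j + handed 4 s)) = 4 * P := by
        have := popped_add s hs
        have := branched_add 4 s hs
        rw [hP, show (4 : ℝ) = 2 ^ 2 by norm_num, ← pow_add]
        congr 1
        omega
      have hpop := one_le_potential (reachable_popped h)
      have hbr := one_le_potential (reachable_branched h hs)
      have hP0 : 0 < P := by positivity
      have hleaf : (numConfigs 4 k (popped s) j r : ℝ) ≤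
          4 ^ r * (P / 2) * potential (popped s) * C := by
        refine (ih (reachable_popped h) j r hr).trans ?_
        rw [← hP]
        calc _ = 4 ^ r * (P / 2) * potential (popped s) * ((j + 4 * k + 2) * (36 / 37) ^ k *
              ((m : ℝ) - r + k + 1) ^ 2 * (numForests 1 m / 4 ^ m)) := by ring
          _ ≤ _ := by
            rw [hC]
            push_cast
            gcongr <;> linarith
      have hC0 : 0 ≤ C := by positivity
      have hstep := mul_le_mul_of_nonneg_left (potential_step h hs)
        (by positivity : 0 ≤ 4 ^ r * P * C)
      have hgoal : 4 ^ r * (2 ^ (s.1 + s.2 + j) / 2) * ((j + 4 * (k + 1 : ℕ) + 2) *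
          (potential s * (36 / 37) ^ (k + 1)) * ((m : ℝ) - r + (k + 1 : ℕ) + 1) ^ 2) *
          (numForests 1 m / 4 ^ m) = 4 ^ r * P * C * (36 / 37 * potential s) := by
        rw [e1, hC]
        ring
      rw [hgoal]
      refine le_trans ?_ hstep
      cases r with
      | zero =>
        rw [numConfigs_succ_zero, if_neg hs]
        refine hleaf.trans ?_
        have : 0 ≤ 4 ^ 0 * (P / 2) * potential (branched 4 s) * C := by positivity
        linarith
      | succ r =>
        rw [numConfigs_succ_succ, if_neg hs, Nat.cast_add]
        have hnode : (numConfigs 4 k (branched 4 s) (j + handed 4 s) r : ℝ) ≤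
            4 ^ r * (4 * P / 2) * potential (branched 4 s) * C := by
          refine (ih (reachable_branched h hs) (j + handed 4 s) r (by omega)).trans ?_
          rw [e2]
          have hh : (handed 4 s : ℝ) ≤ 4 := by exact_mod_cast handed_le s h
          calc _ = 4 ^ r * (4 * P / 2) * potential (branched 4 s) *
                (((j + handed 4 s : ℕ) + 4 * k + 2) * (36 / 37) ^ k *
                ((m : ℝ) - r + k + 1) ^ 2 * (numForests 1 m / 4 ^ m)) := by ring
            _ ≤ _ := by
              have hA : ((j + handed 4 s : ℕ) : ℝ) + 4 * k + 2 ≤ j + 4 * (k + 1 : ℕ) + 2 := by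
                push_cast
                linarith
              have hB : (m : ℝ) - (r + 1 : ℕ) + (k + 1 : ℕ) + 1 = m - r + k + 1 := by
                push_cast
                ring
              rw [hC, hB]
              gcongr 4 ^ r * (4 * P / 2) * potential (branched 4 s) *
                (?_ * (36 / 37) ^ k * ((m : ℝ) - r + k + 1) ^ 2 * (numForests 1 m / 4 ^ m))
        refine (add_le_add hleaf hnode).trans (le_of_eq ?_)
        rw [pow_succ]
        ring

/-- The bound on the law of the lifetime that is uniform in the size of the tree. -/
noncomputable def lifetimeBound (k : ℕ) : ℝ :=
  (4 * k + 2) * (12 * (36 / 37) ^ k) * ((k : ℝ) + 1) ^ 2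

theorem numConfigs_div_le (m k : ℕ) :
    (numConfigs 4 k (1, 0) 0 m : ℝ) / numForests 1 m ≤ lifetimeBound k := by
  have hf : (0 : ℝ) < numForests 1 m := by exact_mod_cast numForests_pos 0 m
  rw [div_le_iff₀ hf]
  refine (numConfigs_le m k (s := (1, 0)) (by simp [Reachable]) 0 m le_rfl).trans (le_of_eq ?_)
  norm_num [potential, lifetimeBound]
  field_simp

theorem summable_mul_lifetimeBound : Summable fun k : ℕ => ((k : ℝ) + 1) * lifetimeBound k := by
  have h : ∀ i : ℕ, Summable fun k : ℕ => (k : ℝ) ^ i * (36 / 37) ^ k := fun i =>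
    summable_pow_mul_geometric_of_norm_lt_one i (by norm_num)
  have := ((h 4).mul_left 48).add (((h 3).mul_left 168).add (((h 2).mul_left 216).add
    (((h 1).mul_left 120).add ((h 0).mul_left 24))))
  refine this.congr fun k => ?_
  unfold lifetimeBound
  ring

/-! ### The generating function and the mean of the limit law -/

theorem endProb_nonneg (t k : ℕ) (s : ℕ × ℕ) : 0 ≤ endProb t k s := by
  induction k generalizing s with
  | zero => rw [endProb]; split_ifs <;> norm_num
  | succ k ih =>
    rw [endProb]
    have := ih (popped s)
    have := ih (branched t s)
    split_ifs <;> positivity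

theorem endHanded_nonneg (t k : ℕ) (s : ℕ × ℕ) : 0 ≤ endHanded t k s := by
  induction k generalizing s with
  | zero => rw [endHanded]; split_ifs <;> positivity
  | succ k ih =>
    rw [endHanded]
    have := ih (popped s)
    have := ih (branched t s)
    have := endProb_nonneg t k (branched t s)
    split_ifs <;> positivity

theorem endProb_le (k : ℕ) {s : ℕ × ℕ} (h : Reachable s) :
    endProb 4 k s ≤ potential s * (36 / 37) ^ k := by
  induction k generalizing s with
  | zero =>
    have := one_le_potential h
    rw [endProb]
    split_ifs <;> linarith
  | succ k ih =>
    have hp := one_le_potential h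
    rw [endProb]
    split_ifs with hs
    · positivity
    · have h1 := ih (reachable_popped h)
      have h2 := ih (reachable_branched h hs)
      have h3 := mul_le_mul_of_nonneg_right (potential_step h hs)
        (by positivity : (0 : ℝ) ≤ (36 / 37) ^ k)
      rw [pow_succ]
      linarith

theorem endHanded_le (k : ℕ) {s : ℕ × ℕ} (h : Reachable s) :
    endHanded 4 k s ≤ 4 * k * (potential s * (36 / 37) ^ k) := by
  induction k generalizing s with
  | zero =>
    rw [endHanded]
    split_ifs with hs
    · have hq : s.2 = 0 := by unfold Reachable at h; omega
      simp [hq]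
    · simp
  | succ k ih =>
    have hp := one_le_potential h
    rw [endHanded]
    split_ifs with hs
    · positivity
    · have h1 := ih (reachable_popped h)
      have h2 := ih (reachable_branched h hs)
      have h3 := mul_le_mul_of_nonneg_left (potential_step h hs)
        (by positivity : (0 : ℝ) ≤ 4 * (k + 1) * (36 / 37) ^ k)
      have h4 : (handed 4 s : ℝ) * endProb 4 k (branched 4 s) ≤
          4 * (potential (branched 4 s) * (36 / 37) ^ k) :=
        mul_le_mul (by exact_mod_cast handed_le s h) (endProb_le k (reachable_branched h hs))
          (endProb_nonneg 4 k _) (by norm_num)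
      have h5 : 0 ≤ potential (popped s) * (36 / 37) ^ k := by
        have := one_le_potential (reachable_popped h)
        positivity
      rw [pow_succ]
      push_cast
      linarith

section Transforms

variable {E : Type*} [NormedAddCommGroup E] [NormedSpace ℝ E]

/-- The transform of `endProb` with threshold four and weights `w`. -/
noncomputable def probTransform (w : ℕ → E) (s : ℕ × ℕ) : E := ∑' k, endProb 4 k s • w k

/-- The transform of `endHanded` with threshold four and weights `w`. -/
noncomputable def handedTransform (w : ℕ → E) (s : ℕ × ℕ) : E := ∑' k, endHanded 4 k s • w k

theorem probTransform_zero (w : ℕ → E) : probTransform w (0, 0) = w 0 := by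
  rw [probTransform, tsum_eq_single 0]
  · simp [endProb]
  · intro k hk
    obtain ⟨k, rfl⟩ := Nat.exists_eq_succ_of_ne_zero hk
    simp [endProb]

theorem handedTransform_zero (w : ℕ → E) : handedTransform w (0, 0) = 0 := by
  rw [handedTransform, tsum_eq_single 0]
  · simp [endHanded]
  · intro k hk
    obtain ⟨k, rfl⟩ := Nat.exists_eq_succ_of_ne_zero hk
    simp [endHanded]

variable [CompleteSpace E]

theorem summable_smul_of_le {x : ℕ → ℝ} {c : ℝ} (hx : ∀ k, 0 ≤ x k)
    (hxc : ∀ k, x k ≤ c * ((k + 1) * (36 / 37) ^ k)) {w : ℕ → E} (hw : ∀ k, ‖w k‖ ≤ k + 2) :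
    Summable fun k => x k • w k := by
  have h : ∀ i : ℕ, Summable fun k : ℕ => (k : ℝ) ^ i * (36 / 37) ^ k := fun i =>
    summable_pow_mul_geometric_of_norm_lt_one i (by norm_num)
  have hs : Summable fun k : ℕ => c * ((k + 1) * (36 / 37 : ℝ) ^ k) * (k + 2) := by
    refine ((((h 2).add ((h 1).mul_left 3)).add ((h 0).mul_left 2)).mul_left c).congr fun k => ?_
    ring
  refine Summable.of_norm_bounded hs fun k => ?_
  rw [norm_smul, Real.norm_of_nonneg (hx k)]
  exact mul_le_mul (hxc k) (hw k) (norm_nonneg _) ((hx k).trans (hxc k))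

theorem summable_endProb {s : ℕ × ℕ} (h : Reachable s) {w : ℕ → E} (hw : ∀ k, ‖w k‖ ≤ k + 2) :
    Summable fun k => endProb 4 k s • w k := by
  have hp := one_le_potential h
  refine summable_smul_of_le (c := potential s) (fun k => endProb_nonneg 4 k s)
    (fun k => (endProb_le k h).trans ?_) hw
  have : (0 : ℝ) ≤ potential s * (k * (36 / 37) ^ k) := by positivity
  linarith

theorem summable_endHanded {s : ℕ × ℕ} (h : Reachable s) {w : ℕ → E} (hw : ∀ k, ‖w k‖ ≤ k + 2) :
    Summable fun k => endHanded 4 k s • w k := by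
  have hp := one_le_potential h
  refine summable_smul_of_le (c := 4 * potential s) (fun k => endHanded_nonneg 4 k s)
    (fun k => (endHanded_le k h).trans ?_) hw
  have : (0 : ℝ) ≤ 4 * (potential s * (36 / 37) ^ k) := by positivity
  linarith

theorem probTransform_eq {w : ℕ → E} (hw : ∀ k, ‖w k‖ ≤ k + 1) {s : ℕ × ℕ} (h : Reachable s)
    (hs : s.1 ≠ 0) : probTransform w s = (2⁻¹ : ℝ) •
      (probTransform (fun k => w (k + 1)) (popped s) +
        probTransform (fun k => w (k + 1)) (branched 4 s)) := by
  have hw' : ∀ k : ℕ, ‖w (k + 1)‖ ≤ k + 2 := fun k => (hw _).trans (by push_cast; linarith)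
  have h1 := summable_endProb (reachable_popped h) hw'
  have h2 := summable_endProb (reachable_branched h hs) hw'
  rw [probTransform, Summable.tsum_eq_zero_add
    (summable_endProb h fun k => (hw k).trans (by linarith)), probTransform, probTransform,
    ← h1.tsum_add h2, ← (h1.add h2).tsum_const_smul]
  simp only [endProb, if_neg hs, zero_smul, zero_add]
  refine tsum_congr fun k => ?_
  module

theorem handedTransform_eq {w : ℕ → E} (hw : ∀ k, ‖w k‖ ≤ k + 1) {s : ℕ × ℕ} (h : Reachable s)
    (hs : s.1 ≠ 0) : handedTransform w s = (2⁻¹ : ℝ) •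
      (handedTransform (fun k => w (k + 1)) (popped s) +
        handedTransform (fun k => w (k + 1)) (branched 4 s) +
        (handed 4 s : ℝ) • probTransform (fun k => w (k + 1)) (branched 4 s)) := by
  have hw' : ∀ k : ℕ, ‖w (k + 1)‖ ≤ k + 2 := fun k => (hw _).trans (by push_cast; linarith)
  have h1 := summable_endHanded (reachable_popped h) hw'
  have h2 := summable_endHanded (reachable_branched h hs) hw'
  have h3 := (summable_endProb (reachable_branched h hs) hw').const_smul (handed 4 s : ℝ)
  rw [handedTransform, Summable.tsum_eq_zero_add
    (summable_endHanded h fun k => (hw k).trans (by linarith)), handedTransform, handedTransform,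
    probTransform, ← h1.tsum_add h2,
    ← (summable_endProb (reachable_branched h hs) hw').tsum_const_smul,
    ← (h1.add h2).tsum_add h3, ← ((h1.add h2).add h3).tsum_const_smul]
  simp only [endHanded, if_neg hs, zero_smul, zero_add]
  refine tsum_congr fun k => ?_
  module

/-- The linear system for the transforms of `endProb`, one equation for each reachable state. -/
theorem probTransform_system {w w' : ℕ → E} (hw : ∀ k, ‖w k‖ ≤ k + 1)
    (hw' : ∀ k, w (k + 1) = w' k) (A A' : ℕ × ℕ → E) (hA : A = probTransform w)
    (hA' : A' = probTransform w') :
    A (1, 0) = (2⁻¹ : ℝ) • (A' (0, 0) + A' (2, 0)) ∧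
    A (2, 0) = (2⁻¹ : ℝ) • (A' (1, 0) + A' (3, 0)) ∧
    A (3, 0) = (2⁻¹ : ℝ) • (A' (2, 0) + A' (4, 0)) ∧
    A (4, 0) = (2⁻¹ : ℝ) • (A' (3, 0) + A' (5, 0)) ∧
    A (5, 0) = (2⁻¹ : ℝ) • (A' (4, 0) + A' (4, 2)) ∧
    A (4, 1) = (2⁻¹ : ℝ) • (A' (4, 0) + A' (4, 2)) ∧
    A (4, 2) = (2⁻¹ : ℝ) • (A' (4, 1) + A' (4, 3)) ∧
    A (4, 3) = (2⁻¹ : ℝ) • (A' (4, 2) + A' (4, 0)) := by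
  obtain rfl : (fun k => w (k + 1)) = w' := funext hw'
  subst hA hA'
  refine ⟨?_, ?_, ?_, ?_, ?_, ?_, ?_, ?_⟩ <;>
    exact probTransform_eq hw (by simp [Reachable]) (by simp)

theorem handedTransform_system {w w' : ℕ → E} (hw : ∀ k, ‖w k‖ ≤ k + 1)
    (hw' : ∀ k, w (k + 1) = w' k) (A' B B' : ℕ × ℕ → E) (hA' : A' = probTransform w')
    (hB : B = handedTransform w) (hB' : B' = handedTransform w') :
    B (1, 0) = (2⁻¹ : ℝ) • (B' (0, 0) + B' (2, 0)) ∧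
    B (2, 0) = (2⁻¹ : ℝ) • (B' (1, 0) + B' (3, 0)) ∧
    B (3, 0) = (2⁻¹ : ℝ) • (B' (2, 0) + B' (4, 0)) ∧
    B (4, 0) = (2⁻¹ : ℝ) • (B' (3, 0) + B' (5, 0)) ∧
    B (5, 0) = (2⁻¹ : ℝ) • (B' (4, 0) + B' (4, 2)) ∧
    B (4, 1) = (2⁻¹ : ℝ) • (B' (4, 0) + B' (4, 2)) ∧
    B (4, 2) = (2⁻¹ : ℝ) • (B' (4, 1) + B' (4, 3)) ∧
    B (4, 3) = (2⁻¹ : ℝ) • (B' (4, 2) + B' (4, 0) + (4 : ℝ) • A' (4, 0)) := by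
  obtain rfl : (fun k => w (k + 1)) = w' := funext hw'
  subst hA' hB hB'
  refine ⟨?_, ?_, ?_, ?_, ?_, ?_, ?_, ?_⟩ <;>
    refine (handedTransform_eq hw (by simp [Reachable]) (by simp)).trans ?_ <;>
    simp [popped, branched, handed]

end Transforms

theorem norm_pow_le_succ {u : ℂ} (hu : ‖u‖ ≤ 1) (k : ℕ) : ‖u ^ k‖ ≤ k + 1 := by
  rw [norm_pow]
  exact (pow_le_one₀ (norm_nonneg u) hu).trans (by linarith [(Nat.cast_nonneg k : (0 : ℝ) ≤ k)])

/-- The probability generating function of the limit law. -/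
theorem handedTransform_pow {u : ℂ} (hu : ‖u‖ ≤ 1) :
    handedTransform (fun k => u ^ k) (1, 0) =
      -(u ^ 11 / ((u ^ 4 - 16 * u ^ 2 + 16) * (u ^ 6 - 18 * u ^ 4 + 48 * u ^ 2 - 32))) := by
  obtain ⟨A, hA⟩ : ∃ A, A = probTransform fun k => u ^ k := ⟨_, rfl⟩
  obtain ⟨B, hB⟩ : ∃ B, B = handedTransform fun k => u ^ k := ⟨_, rfl⟩
  have hA' : (fun s => u * A s) = probTransform fun k => u * u ^ k := by
    funext s
    simp only [hA, probTransform, ← tsum_mul_left, mul_smul_comm]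
  have hB' : (fun s => u * B s) = handedTransform fun k => u * u ^ k := by
    funext s
    simp only [hB, handedTransform, ← tsum_mul_left, mul_smul_comm]
  obtain ⟨a1, a2, a3, a4, a5, c1, c2, c3⟩ := probTransform_system (norm_pow_le_succ hu)
    (fun k => pow_succ' u k) A _ hA hA'
  obtain ⟨b1, b2, b3, b4, b5, e1, e2, e3⟩ := handedTransform_system (norm_pow_le_succ hu)
    (fun k => pow_succ' u k) _ B _ hA' hB hB'
  have a0 : A (0, 0) = 1 := by simp [hA, probTransform_zero]
  have b0 : B (0, 0) = 0 := by simp [hB, handedTransform_zero]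
  simp only [Complex.real_smul, Complex.ofReal_inv, Complex.ofReal_ofNat, a0, b0] at *
  -- Elimination for `A`: down from state `4` through the states with `lds₂` in use, and up
  -- from state `1`.
  have a5' : (2 - u ^ 2) * A (5, 0) = u * A (4, 0) := by
    linear_combination 2 * a5 + u * c2 + u ^ 2 / 2 * (c1 - a5) + u ^ 2 / 2 * (c3 - a5)
  have a2' : (4 - u ^ 2) * A (2, 0) = u ^ 2 + 2 * u * A (3, 0) := by
    linear_combination 4 * a2 + 2 * u * a1
  have a3' : (8 - 4 * u ^ 2) * A (3, 0) = u ^ 3 + u * (4 - u ^ 2) * A (4, 0) := by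
    linear_combination 2 * (4 - u ^ 2) * a3 + u * a2'
  have a4' : (u ^ 4 - 16 * u ^ 2 + 16) * A (4, 0) = u ^ 4 := by
    linear_combination 8 * (2 - u ^ 2) * a4 + u * a3' + 4 * u * a5'
  -- Elimination for `B`, with `A (4, 0)` as the source term.
  have b5' : (2 - u ^ 2) * B (5, 0) = u * B (4, 0) + u ^ 3 * A (4, 0) := by
    linear_combination 2 * b5 + u * e2 + u ^ 2 / 2 * (e1 - b5) + u ^ 2 / 2 * (e3 - b5)
  have b4' : (4 - 3 * u ^ 2) * B (4, 0) =
      u * (2 - u ^ 2) * B (3, 0) + u ^ 4 * A (4, 0) := by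
    linear_combination 2 * (2 - u ^ 2) * b4 + u * b5'
  have b3' : (8 - 8 * u ^ 2 + u ^ 4) * B (3, 0) =
      u * (4 - 3 * u ^ 2) * B (2, 0) + u ^ 5 * A (4, 0) := by
    linear_combination 2 * (4 - 3 * u ^ 2) * b3 + u * b4'
  have b2' : (16 - 20 * u ^ 2 + 5 * u ^ 4) * B (2, 0) =
      u * (8 - 8 * u ^ 2 + u ^ 4) * B (1, 0) + u ^ 6 * A (4, 0) := by
    linear_combination 2 * (8 - 8 * u ^ 2 + u ^ 4) * b2 + u * b3'
  have b1' : (32 - 48 * u ^ 2 + 18 * u ^ 4 - u ^ 6) * B (1, 0) = u ^ 7 * A (4, 0) := by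
    linear_combination 2 * (16 - 20 * u ^ 2 + 5 * u ^ 4) * b1 + u * b2'
  have hu2 : ‖u ^ 2‖ ≤ 1 := by
    rw [norm_pow]
    exact pow_le_one₀ (norm_nonneg u) hu
  have hd1 : u ^ 4 - 16 * u ^ 2 + 16 ≠ 0 := by
    -- The zeros satisfy `(u² - 8)² = 48`, but `|u² - 8| ≥ 7`.
    intro h0
    have h1 : (8 - u ^ 2) ^ 2 = 48 := by linear_combination h0
    have h2 : ‖8 - u ^ 2‖ ^ 2 = 48 := by rw [← norm_pow, h1]; norm_num
    have h3 := norm_sub_norm_le (8 : ℂ) (u ^ 2)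
    have h4 : ‖(8 : ℂ)‖ = 8 := by norm_num
    nlinarith
  have hd2 : u ^ 6 - 18 * u ^ 4 + 48 * u ^ 2 - 32 ≠ 0 := by
    have h0 : u ^ 2 - 2 ≠ 0 := by
      intro h0
      rw [sub_eq_zero.1 h0] at hu2
      norm_num at hu2
    have h1 : u ^ 6 - 18 * u ^ 4 + 48 * u ^ 2 - 32 =
      (u ^ 2 - 2) * (u ^ 4 - 16 * u ^ 2 + 16) := by ring
    rw [h1]
    exact mul_ne_zero h0 hd1
  rw [← hB, ← neg_div, eq_div_iff (mul_ne_zero hd1 hd2)]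
  linear_combination -(u ^ 4 - 16 * u ^ 2 + 16) * b1' - u ^ 7 * a4'

theorem handedTransform_natCast : handedTransform (fun k => (k : ℝ)) (1, 0) = 69 := by
  obtain ⟨A, hA⟩ : ∃ A, A = probTransform fun _ => (1 : ℝ) := ⟨_, rfl⟩
  obtain ⟨B, hB⟩ : ∃ B, B = handedTransform fun _ => (1 : ℝ) := ⟨_, rfl⟩
  obtain ⟨F, hF⟩ : ∃ F, F = probTransform fun k => (k : ℝ) := ⟨_, rfl⟩
  obtain ⟨G, hG⟩ : ∃ G, G = handedTransform fun k => (k : ℝ) := ⟨_, rfl⟩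
  have hw1 : ∀ k : ℕ, ‖(1 : ℝ)‖ ≤ k + 1 := fun k => by simp
  have hw2 : ∀ k : ℕ, ‖(k : ℝ)‖ ≤ k + 1 := fun k => by simp
  have hFA : ∀ s, Reachable s → probTransform (fun k : ℕ => ((k + 1 : ℕ) : ℝ)) s = F s + A s := by
    intro s h
    rw [hF, hA, probTransform, probTransform, probTransform, ← (summable_endProb h fun k =>
      (hw2 k).trans (by linarith)).tsum_add (summable_endProb h fun k =>
      (hw1 k).trans (by linarith))]
    exact tsum_congr fun k => by push_cast; module
  have hGB : ∀ s, Reachable s →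
      handedTransform (fun k : ℕ => ((k + 1 : ℕ) : ℝ)) s = G s + B s := by
    intro s h
    rw [hG, hB, handedTransform, handedTransform, handedTransform, ← (summable_endHanded h fun k =>
      (hw2 k).trans (by linarith)).tsum_add (summable_endHanded h fun k =>
      (hw1 k).trans (by linarith))]
    exact tsum_congr fun k => by push_cast; module
  have hr : Reachable (0, 0) ∧ Reachable (1, 0) ∧ Reachable (2, 0) ∧ Reachable (3, 0) ∧
      Reachable (4, 0) ∧ Reachable (5, 0) ∧ Reachable (4, 1) ∧ Reachable (4, 2) ∧
      Reachable (4, 3) := by simp [Reachable]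
  obtain ⟨r0, r1, r2, r3, r4, r5, q1, q2, q3⟩ := hr
  obtain ⟨a1, a2, a3, a4, a5, c1, c2, c3⟩ := probTransform_system hw1 (fun _ => rfl) A A hA hA
  obtain ⟨b1, b2, b3, b4, b5, e1, e2, e3⟩ :=
    handedTransform_system hw1 (fun _ => rfl) A B B hA hB hB
  have f := probTransform_system hw2 (fun _ => rfl) F _ hF rfl
  have g := handedTransform_system hw2 (fun _ => rfl) _ G _ rfl hG rfl
  rw [hFA _ r0, hFA _ r1, hFA _ r2, hFA _ r3, hFA _ r4, hFA _ r5, hFA _ q1, hFA _ q2,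
    hFA _ q3] at f
  rw [hGB _ r0, hGB _ r1, hGB _ r2, hGB _ r3, hGB _ r4, hGB _ r5, hGB _ q1, hGB _ q2,
    hGB _ q3, hFA _ r4] at g
  obtain ⟨f1, f2, f3, f4, f5, h1, h2, h3⟩ := f
  obtain ⟨g1, g2, g3, g4, g5, i1, i2, i3⟩ := g
  have a0 : A (0, 0) = 1 := by simp [hA, probTransform_zero]
  have b0 : B (0, 0) = 0 := by simp [hB, handedTransform_zero]
  have f0 : F (0, 0) = 0 := by simp [hF, probTransform_zero]
  have g0 : G (0, 0) = 0 := by simp [hG, handedTransform_zero]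
  rw [← hG]
  simp only [smul_eq_mul, a0, b0, f0, g0] at *
  linarith

/-! ### The law of the lifetime on uniform trees -/

theorem tsum_ind (P : PlaneTree → Prop) : ∑' T, ind (P T) = Measure.count {T | P T} := by
  classical
  rw [← lintegral_indicator_one (DiscreteMeasurableSpace.forall_measurableSet {T | P T}),
    lintegral_count]
  exact tsum_congr fun T => by simp [ind, Set.indicator_apply]

theorem mem_treesOfSize_iff (m : ℕ) (T : PlaneTree) :
    T ∈ treesOfSize (2 * m + 1) ↔ T.numNodes = m := by
  rw [treesOfSize_eq, SetLike.mem_coe, BinaryTree.mem_treesOfNumNodesEq]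

theorem count_treesOfSize (m : ℕ) :
    Measure.count (treesOfSize (2 * m + 1)) = numForests 1 m := by
  have h : treesOfSize (2 * m + 1) = {T | T.numNodes = m} :=
    Set.ext fun T => mem_treesOfSize_iff m T
  rw [h, ← tsum_ind, ← forestSum_ind_forestNodes]
  simp [forestSum, forestNodes]

theorem measureReal_uniformTree_lifetime (d : Discipline) (t k m : ℕ) :
    (uniformTree m).real {T | firstThreadLifetime d t T = k} =
      (numConfigs t k (1, 0) 0 m : ℝ) / numForests 1 m := by
  have h : treesOfSize (2 * m + 1) ∩ {T | firstThreadLifetime d t T = k} =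
      {T | firstThreadLifetime d t T = k ∧ T.numNodes = m} :=
    Set.ext fun T => by
      rw [Set.mem_inter_iff, mem_treesOfSize_iff, and_comm]
      rfl
  rw [Measure.real, uniformTree, uniformOn,
    cond_apply (DiscreteMeasurableSpace.forall_measurableSet _), h, ← tsum_ind,
    tsum_ind_firstThreadLifetime, count_treesOfSize, ENNReal.toReal_mul, ENNReal.toReal_inv,
    ENNReal.toReal_natCast, ENNReal.toReal_natCast, div_eq_inv_mul]

theorem integrable_uniformTree (m : ℕ) (f : PlaneTree → ℝ) : Integrable f (uniformTree m) := by
  have hfin : (treesOfSize (2 * m + 1)).Finite := by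
    rw [treesOfSize_eq]
    exact Finset.finite_toSet _
  have h1 : IntegrableOn f (treesOfSize (2 * m + 1)) (uniformTree m) := IntegrableOn.of_finite hfin
  have h2 : ∀ᵐ T ∂uniformTree m, T ∈ treesOfSize (2 * m + 1) :=
    ae_cond_mem (DiscreteMeasurableSpace.forall_measurableSet _)
  rwa [IntegrableOn, Measure.restrict_eq_self_of_ae_mem h2] at h1

theorem integral_lifetime_eq_tsum (d : Discipline) (m : ℕ) (g : ℕ → ℝ) :
    ∫ T, g (firstThreadLifetime d 4 T) ∂uniformTree m =
      ∑' k, (numConfigs 4 k (1, 0) 0 m : ℝ) / numForests 1 m * g k := by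
  have hL : AEMeasurable (firstThreadLifetime d 4) (uniformTree m) :=
    measurable_from_top.aemeasurable
  have hg : AEStronglyMeasurable g ((uniformTree m).map (firstThreadLifetime d 4)) :=
    measurable_from_top.aestronglyMeasurable
  have hi : Integrable g ((uniformTree m).map (firstThreadLifetime d 4)) :=
    (integrable_map_measure hg hL).2 (integrable_uniformTree m _)
  rw [← integral_map hL hg, integral_countable hi]
  refine tsum_congr fun k => ?_
  rw [map_measureReal_apply measurable_from_top (measurableSet_singleton k), smul_eq_mul,
    ← measureReal_uniformTree_lifetime d]
  rfl

/-- Convergence of the expectation of every function of the lifetime of at most linear growth. -/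
theorem tendsto_integral_lifetime (d : Discipline) {g : ℕ → ℝ} {c : ℝ}
    (hg : ∀ k, |g k| ≤ c * (k + 1)) :
    Tendsto (fun m => ∫ T, g (firstThreadLifetime d 4 T) ∂uniformTree m) atTop
      (𝓝 (∑' k, endHanded 4 k (1, 0) * g k)) := by
  simp_rw [integral_lifetime_eq_tsum]
  refine tendsto_tsum_of_dominated_convergence (summable_mul_lifetimeBound.mul_left c)
    (fun k => ?_) (Eventually.of_forall fun m k => ?_)
  · refine Tendsto.mul_const _ ?_
    simpa using tendsto_numConfigs_div 4 k (1, 0) 0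
  · have h := numConfigs_div_le m k
    have h0 : (0 : ℝ) ≤ (numConfigs 4 k (1, 0) 0 m : ℝ) / numForests 1 m := by positivity
    rw [norm_mul, Real.norm_of_nonneg h0, Real.norm_eq_abs]
    calc _ ≤ lifetimeBound k * (c * (k + 1)) := mul_le_mul h (hg k) (abs_nonneg _) (h0.trans h)
      _ = _ := by ring

theorem tsum_endHanded : ∑' k, endHanded 4 k (1, 0) = 1 := by
  have h : ((∑' k, endHanded 4 k (1, 0) : ℝ) : ℂ) = 1 := by
    have := handedTransform_pow (u := 1) (by simp)
    simp only [handedTransform, one_pow, Complex.real_smul, mul_one] at this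
    rw [Complex.ofReal_tsum, this]
    norm_num
  exact_mod_cast h

theorem summable_endHanded_one : Summable fun k => endHanded 4 k (1, 0) := by
  simpa using summable_endHanded (s := (1, 0)) (by simp [Reachable]) (w := fun _ => (1 : ℝ))
    (fun k => by simp; linarith [(Nat.cast_nonneg k : (0 : ℝ) ≤ k)])

/-- The limit law of the lifetime, which gives `k` the expected number of nodes handed over on the
event that the chain of lengths ends after `k` steps. -/
noncomputable def limitLaw : PMF ℕ :=
  ⟨fun k => ENNReal.ofReal (endHanded 4 k (1, 0)), by
    rw [ENNReal.summable.hasSum_iff, ← ENNReal.ofReal_tsum_of_nonneg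
      (fun k => endHanded_nonneg 4 k _) summable_endHanded_one, tsum_endHanded,
      ENNReal.ofReal_one]⟩

theorem toReal_limitLaw (k : ℕ) : (limitLaw k).toReal = endHanded 4 k (1, 0) :=
  ENNReal.toReal_ofReal (endHanded_nonneg 4 k _)

theorem tendstoInDistribution_lifetime (d : Discipline) :
    TendstoInDistribution (fun (_ : ℕ) (T : PlaneTree) => (firstThreadLifetime d 4 T : ℝ))
      atTop (fun k : ℕ => (k : ℝ)) (fun m : ℕ => uniformTree m) limitLaw.toMeasure where
  forall_aemeasurable _ := measurable_from_top.aemeasurable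
  aemeasurable_limit := measurable_from_top.aemeasurable
  tendsto := by
    refine ProbabilityMeasure.tendsto_iff_forall_integral_tendsto.2 fun f => ?_
    have h1 : ∀ m, ∫ x, f x ∂((uniformTree m).map fun T => (firstThreadLifetime d 4 T : ℝ)) =
        ∫ T, f (firstThreadLifetime d 4 T) ∂uniformTree m := fun m =>
      integral_map measurable_from_top.aemeasurable f.continuous.aestronglyMeasurable
    have h2 : ∫ x, f x ∂(limitLaw.toMeasure.map fun k : ℕ => (k : ℝ)) =
        ∑' k : ℕ, endHanded 4 k (1, 0) * f k := by
      rw [integral_map measurable_from_top.aemeasurable f.continuous.aestronglyMeasurable,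
        PMF.integral_eq_tsum]
      · simp [toReal_limitLaw]
      · exact .of_bound measurable_from_top.aestronglyMeasurable ‖f‖
          (Eventually.of_forall fun k => f.norm_coe_le_norm k)
    simp only [ProbabilityMeasure.coe_mk, h1, h2]
    refine tendsto_integral_lifetime d (g := fun k : ℕ => f k) (c := ‖f‖) fun k => ?_
    refine (f.norm_coe_le_norm k).trans (le_mul_of_one_le_right (norm_nonneg f) ?_)
    linarith [(Nat.cast_nonneg k : (0 : ℝ) ≤ k)]

end ParallelGW

theorem mainTheorem3 (d : ParallelGW.Discipline) :
    (∃ p : PMF ℕ,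
      (∀ u : ℂ, ‖u‖ ≤ 1 →
        HasSum (fun k : ℕ => ((p k).toReal : ℂ) * u ^ k)
          (-(u ^ 11 / ((u ^ 4 - 16 * u ^ 2 + 16) *
            (u ^ 6 - 18 * u ^ 4 + 48 * u ^ 2 - 32))))) ∧
      HasSum (fun k : ℕ => (k : ℝ) * (p k).toReal) 69 ∧
      TendstoInDistribution
        (fun (_ : ℕ) (T : ParallelGW.PlaneTree) =>
          (ParallelGW.firstThreadLifetime d 4 T : ℝ))
        atTop (fun k : ℕ => (k : ℝ)) (fun m : ℕ => ParallelGW.uniformTree m) p.toMeasure) ∧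
    Tendsto
      (fun m : ℕ => ∫ T, (ParallelGW.firstThreadLifetime d 4 T : ℝ) ∂(ParallelGW.uniformTree m))
      atTop (𝓝 69) := by
  open ParallelGW in
  have hr : Reachable (1, 0) := by simp [Reachable]
  refine ⟨⟨limitLaw, fun u hu => ?_, ?_, tendstoInDistribution_lifetime d⟩, ?_⟩
  · rw [← handedTransform_pow hu, handedTransform]
    simpa only [toReal_limitLaw, Complex.real_smul] using (summable_endHanded hr fun k =>
      (norm_pow_le_succ hu k).trans (by linarith)).hasSum
  · rw [← handedTransform_natCast, handedTransform]
    simpa only [toReal_limitLaw, smul_eq_mul, mul_comm] using (summable_endHanded hr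
      (w := fun k => (k : ℝ)) fun k => by simp).hasSum
  · rw [← handedTransform_natCast, handedTransform]
    refine tendsto_integral_lifetime d (g := fun k => (k : ℝ)) (c := 1) fun k => ?_
    simp
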